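/- **Theorem.** Let $n\ge 1$, let $S^{n-1}$ be the unit sphere of $\mathbb{R}^n$, let $q<0$ be real, and let $\mu$ be a non-zero finite Borel measure on $S^{n-1}$. Then the following are equivalent: (i) there is a convex body $K\subset\mathbb{R}^n$ (a compact convex set) with the origin in its interior such that $\mu(\eta)=\widetilde C_q(K,\eta)$ for every Borel set $\eta\subset S^{n-1}$; (ii) $\mu$ is not concentrated in any closed hemisphere, that is, $\mu(\{v\in S^{n-1}: v\cdot w<0\})>0$ for every $w\in S^{n-1}$. Here $\widetilde C_q(K,\cdot)$ is the $q$-th dual curvature measure of $K$, $$\widetilde C_q(K,\eta)=\frac1n\int_{\vec{\alpha}_K^*(\eta)}\rho_K(u)^q\,du ,$$ where $du$ is the spherical Lebesgue measure (of total mass $n\omega_n$, with $\omega_n$ the volume of the unit ball), $\rho_K(u)=\max\{r>0: ru\in K\}$ is the radial function, $h_K(v)=\max\{v\cdot x: x\in K\}$ is the support function, and $$\vec{\alpha}_K^*(\eta)=\{u\in S^{n-1}:\ \rho_K(u)\,u\cdot v=h_K(v)\ \text{for some } v\in\eta\}$$ is the reverse radial Gauss image of $\eta$, i.e. the set of directions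 $u$ such that the boundary point $\rho_K(u)u$ of $K$ has an outer unit normal in $\eta$. -/

import Mathlib

open MeasureTheory
open scoped ENNReal

namespace DualMinkowski

/-- The Euclidean space `ℝⁿ`. -/
abbrev E (n : ℕ) : Type := EuclideanSpace ℝ (Fin n)

/-- The unit sphere `S^{n-1}` of `ℝⁿ`. -/
abbrev S (n : ℕ) : Type := Metric.sphere (0 : E n) 1

/-- The spherical Lebesgue measure on `S^{n-1}`, of total mass `n ωₙ`. -/
noncomputable def sphericalMeasure (n : ℕ) : Measure (S n) :=
  (volume : Measure (E n)).toSphere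

/-- The support function `h_K(v) = max {v · x : x ∈ K}`. -/
noncomputable def supportFn {n : ℕ} (K : ConvexBody (E n)) (v : S n) : ℝ :=
  sSup ((fun x : E n => inner ℝ (v : E n) x) '' (K : Set (E n)))

/-- The radial function `ρ_K(u) = max {r > 0 : r u ∈ K}`. -/
noncomputable def radialFn {n : ℕ} (K : ConvexBody (E n)) (u : S n) : ℝ :=
  sSup {r : ℝ | 0 < r ∧ r • (u : E n) ∈ K}

/-- `v` is an outer unit normal of `K` at the point `x`: the supporting hyperplane
`{y : y · v = h_K(v)}` passes through `x`. It is used for boundary points `x` of `K` only. -/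
def IsOuterUnitNormal {n : ℕ} (K : ConvexBody (E n)) (x : E n) (v : S n) : Prop :=
  inner ℝ x (v : E n) = supportFn K v

/-- The radial Gauss image of `ω ⊆ S^{n-1}`: all outer unit normals of `K` at the boundary points
`ρ_K(u) u`, `u ∈ ω`. -/
def radialGaussImage {n : ℕ} (K : ConvexBody (E n)) (ω : Set (S n)) : Set (S n) :=
  {v | ∃ u ∈ ω, IsOuterUnitNormal K (radialFn K u • (u : E n)) v}

/-- The reverse radial Gauss image of `η ⊆ S^{n-1}`: all directions `u` for which some element
of `η` is an outer unit normal of `K` at `ρ_K(u) u`. -/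
def reverseRadialGaussImage {n : ℕ} (K : ConvexBody (E n)) (η : Set (S n)) : Set (S n) :=
  {u | (radialGaussImage K {u} ∩ η).Nonempty}

/-- The `q`-th dual curvature measure of `K`, evaluated at `η ⊆ S^{n-1}`:
the integral of `ρ_K(u)^q` over the reverse radial Gauss image of `η`, divided by `n`. -/
noncomputable def dualCurvatureMeasure {n : ℕ} (q : ℝ) (K : ConvexBody (E n)) (η : Set (S n)) :
    ℝ≥0∞ :=
  (n : ℝ≥0∞)⁻¹ *
    ∫⁻ u in reverseRadialGaussImage K η, ENNReal.ofReal (radialFn K u ^ q) ∂(sphericalMeasure n)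

/-- The closed hemisphere of `S^{n-1}` with pole `w`. -/
def closedHemisphere {n : ℕ} (w : S n) : Set (S n) :=
  {v | 0 ≤ inner ℝ (v : E n) (w : E n)}

/-- The measure `μ` is concentrated in the set `A`. -/
def ConcentratedIn {n : ℕ} (μ : Measure (S n)) (A : Set (S n)) : Prop :=
  μ Aᶜ = 0

end DualMinkowski

/-!
The theorem is proved variationally, in the logarithmic coordinate `φ = log h` and with `p = -q > 0`.
A continuous `φ` on the sphere determines the Wulff shape `K = {x | ∀ v, x · v ≤ exp (φ v)}`, whose
radial function satisfies `-log ρ_K = logConj φ`, where `logConj φ u = sup_v (log (u · v) - φ v)`.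
The map `logConj` is an order-reversing, `1`-Lipschitz conjugation with `logConj ∘ logConj ≤ id`;
its double application replaces `exp φ` by the support function of `K` and does not change `ρ_K`.

For sufficiency, the functional `energy φ = ∫ φ dμ + (1 / (p n)) ∫ ρ_K ^ (-p) du` is minimized over
all continuous `φ`. Passing to the double conjugate does not increase it. If `r` and `R` are
the inner and outer radius of `K` about the origin, then `ρ_K(u) ≤ r / (u · v₀)₊` for some `v₀`
bounds the second term below by a multiple of `r ^ (-p)`, and `h_K(v) ≥ max r (R (v · u₀)₊)` for
some `u₀`, together with the hypothesis on `μ`, bounds the first term below by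
`m (log R - log r) + μ(S) (log r - 1)` with `m > 0` (`exists_coercive_bound`). Since `q < 0`, the
power of `r` dominates the logarithm, so `r` and `R` are confined to a compact range and
Arzelà-Ascoli yields a minimizer (`exists_minimizer`).

The gauge of `K` is Lipschitz, hence differentiable almost everywhere, and where it is, the outer
unit normal of `K` is unique, namely the normalized gradient (`IsMaximizer.eq_gaugeNormal`). By an
envelope argument (`hasDerivAt_logConj`), the derivative of `logConj (φ + t g)` at `t = 0` is
`-g ∘ gaugeNormal φ` almost everywhere. So the Euler-Lagrange equation (`integral_eq_of_minimizer`)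
says that `μ` is the push-forward of `ρ_K ^ q / n` under the normal map, which is the dual curvature
measure of `K`.

For necessity, the normals of `K` at boundary points in directions near `-w` all satisfy `v · w < 0`
(`not_concentratedIn_of_dualCurvatureMeasure`), and those directions form a nonempty open set.
-/

namespace DualMinkowski

open Filter Topology Real

variable {n : ℕ}

/-! ### The gauge of a Wulff shape and the logarithmic conjugate -/

section Conjugate

/-- The gauge function of the Wulff shape `{x | ∀ v, x · v ≤ exp (φ v)}` of `exp φ`,
that is, the support function of its polar body. -/
noncomputable def wulffGauge (φ : C(S n, ℝ)) (x : E n) : ℝ :=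
  ⨆ v : S n, exp (-φ v) * inner ℝ x (v : E n)

lemma bddAbove_wulffGauge (φ : C(S n, ℝ)) (x : E n) :
    BddAbove (Set.range fun v : S n => exp (-φ v) * inner ℝ x (v : E n)) :=
  (isCompact_range (by fun_prop)).bddAbove

lemma le_wulffGauge (φ : C(S n, ℝ)) (x : E n) (v : S n) :
    exp (-φ v) * inner ℝ x (v : E n) ≤ wulffGauge φ x :=
  le_ciSup (bddAbove_wulffGauge φ x) v

lemma exists_eq_wulffGauge [Nonempty (S n)] (φ : C(S n, ℝ)) (x : E n) :
    ∃ v : S n, exp (-φ v) * inner ℝ x (v : E n) = wulffGauge φ x := by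
  have hc : Continuous fun v : S n => exp (-φ v) * inner ℝ x (v : E n) := by fun_prop
  obtain ⟨v, -, hv⟩ := isCompact_univ.exists_isMaxOn Set.univ_nonempty hc.continuousOn
  refine ⟨v, le_antisymm (le_wulffGauge φ x v) (ciSup_le fun w => hv (Set.mem_univ w))⟩

lemma inner_self_sphere (u : S n) : inner ℝ (u : E n) (u : E n) = (1 : ℝ) := by
  rw [real_inner_self_eq_norm_sq, norm_eq_of_mem_sphere]; norm_num

lemma exp_neg_le_wulffGauge (φ : C(S n, ℝ)) (u : S n) : exp (-φ u) ≤ wulffGauge φ u := by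
  simpa [inner_self_sphere] using le_wulffGauge φ u u

lemma wulffGauge_pos (φ : C(S n, ℝ)) (u : S n) : 0 < wulffGauge φ u :=
  (exp_pos _).trans_le (exp_neg_le_wulffGauge φ u)

lemma wulffGauge_smul [Nonempty (S n)] (φ : C(S n, ℝ)) {t : ℝ} (ht : 0 ≤ t) (x : E n) :
    wulffGauge φ (t • x) = t * wulffGauge φ x := by
  unfold wulffGauge
  rw [Real.mul_iSup_of_nonneg ht]
  congr 1; ext v
  rw [real_inner_smul_left]; ring

lemma wulffGauge_sub_le [Nonempty (S n)] (φ : C(S n, ℝ)) {b : ℝ} (hb : ∀ v, -φ v ≤ b)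
    (x y : E n) : wulffGauge φ x - wulffGauge φ y ≤ exp b * ‖x - y‖ := by
  obtain ⟨v, hv⟩ := exists_eq_wulffGauge φ x
  have h1 := le_wulffGauge φ y v
  have h2 : inner ℝ x (v : E n) - inner ℝ y (v : E n) ≤ ‖x - y‖ := by
    rw [← inner_sub_left]
    simpa [norm_eq_of_mem_sphere] using real_inner_le_norm (x - y) (v : E n)
  calc wulffGauge φ x - wulffGauge φ y
      ≤ exp (-φ v) * (inner ℝ x (v : E n) - inner ℝ y (v : E n)) := by rw [mul_sub]; linarith
    _ ≤ exp (-φ v) * ‖x - y‖ := by gcongr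
    _ ≤ exp b * ‖x - y‖ := by gcongr; exact hb v

lemma lipschitzWith_wulffGauge [Nonempty (S n)] (φ : C(S n, ℝ)) {b : ℝ} (hb : ∀ v, -φ v ≤ b) :
    LipschitzWith (exp b).toNNReal (wulffGauge φ) :=
  LipschitzWith.of_le_add_mul' _ fun x y => by
    have := wulffGauge_sub_le φ hb x y
    rw [dist_eq_norm]; linarith

lemma neg_le_norm (φ : C(S n, ℝ)) (v : S n) : -φ v ≤ ‖φ‖ :=
  (neg_le_abs _).trans (φ.norm_coe_le_norm v)

lemma continuous_wulffGauge [Nonempty (S n)] (φ : C(S n, ℝ)) : Continuous (wulffGauge φ) :=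
  (lipschitzWith_wulffGauge φ (neg_le_norm φ)).continuous

/-- The logarithmic conjugate `u ↦ sup_v (log (u · v) - φ v)` of `φ`. If `φ = log h_K`, it is
`-log ρ_K`, so it plays the role of the polar body in logarithmic coordinates. -/
noncomputable def logConj [Nonempty (S n)] (φ : C(S n, ℝ)) : C(S n, ℝ) where
  toFun u := log (wulffGauge φ u)
  continuous_toFun := ((continuous_wulffGauge φ).comp continuous_subtype_val).log
    fun u => (wulffGauge_pos φ u).ne'

variable [Nonempty (S n)]

lemma exp_logConj (φ : C(S n, ℝ)) (u : S n) : exp (logConj φ u) = wulffGauge φ u :=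
  exp_log (wulffGauge_pos φ u)

lemma inner_le_exp_add (φ : C(S n, ℝ)) (u v : S n) :
    inner ℝ (u : E n) (v : E n) ≤ exp (φ v + logConj φ u) := by
  have := le_wulffGauge φ u v
  rw [exp_add, exp_logConj]
  calc inner ℝ (u : E n) (v : E n)
      = exp (φ v) * (exp (-φ v) * inner ℝ (u : E n) (v : E n)) := by
        rw [← mul_assoc, ← exp_add]; simp
    _ ≤ _ := by gcongr

lemma exists_inner_eq_exp_add (φ : C(S n, ℝ)) (u : S n) :
    ∃ v : S n, inner ℝ (u : E n) (v : E n) = exp (φ v + logConj φ u) := by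
  obtain ⟨v, hv⟩ := exists_eq_wulffGauge φ u
  refine ⟨v, ?_⟩
  rw [exp_add, exp_logConj, ← hv, ← mul_assoc, ← exp_add]; simp

/-- `logConj φ u` is the least `c` with `u · v ≤ exp (φ v + c)` for all `v`. -/
lemma logConj_le_iff (φ : C(S n, ℝ)) (u : S n) (c : ℝ) :
    logConj φ u ≤ c ↔ ∀ v : S n, inner ℝ (u : E n) (v : E n) ≤ exp (φ v + c) := by
  constructor
  · intro h v
    exact (inner_le_exp_add φ u v).trans (by gcongr)
  · intro h
    obtain ⟨v, hv⟩ := exists_inner_eq_exp_add φ u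
    have := h v
    rw [hv, exp_le_exp] at this
    linarith

lemma logConj_logConj_le (φ : C(S n, ℝ)) (v : S n) : logConj (logConj φ) v ≤ φ v := by
  rw [logConj_le_iff]
  intro u
  rw [real_inner_comm, add_comm]
  exact inner_le_exp_add φ u v

lemma logConj_anti {φ ψ : C(S n, ℝ)} (h : ∀ v, φ v ≤ ψ v) (u : S n) :
    logConj ψ u ≤ logConj φ u := by
  rw [logConj_le_iff]
  intro v
  exact (inner_le_exp_add φ u v).trans (by gcongr; exact h v)

lemma logConj_logConj_logConj (φ : C(S n, ℝ)) : logConj (logConj (logConj φ)) = logConj φ := by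
  ext u
  exact le_antisymm (logConj_logConj_le _ u) (logConj_anti (logConj_logConj_le φ) u)

lemma logConj_le_add {φ ψ : C(S n, ℝ)} {c : ℝ} (h : ∀ v, φ v ≤ ψ v + c) (u : S n) :
    logConj ψ u ≤ logConj φ u + c := by
  rw [logConj_le_iff]
  intro v
  refine (inner_le_exp_add φ u v).trans ?_
  exact exp_le_exp.2 (by linarith [h v])

lemma lipschitzWith_logConj : LipschitzWith 1 (logConj : C(S n, ℝ) → C(S n, ℝ)) := by
  refine LipschitzWith.of_dist_le_mul fun φ ψ => ?_
  rw [NNReal.coe_one, one_mul, ContinuousMap.dist_le dist_nonneg]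
  intro u
  have h : ∀ v, |φ v - ψ v| ≤ dist φ ψ := fun v => by
    rw [← Real.dist_eq]; exact ContinuousMap.dist_apply_le_dist v
  rw [Real.dist_eq, abs_sub_le_iff]
  constructor
  · have := logConj_le_add (φ := ψ) (ψ := φ) (c := dist φ ψ)
      (fun v => by linarith [(abs_le.1 (h v)).1]) u
    linarith
  · have := logConj_le_add (φ := φ) (ψ := ψ) (c := dist φ ψ)
      (fun v => by linarith [(abs_le.1 (h v)).2]) u
    linarith

end Conjugate

/-! ### The energy functional and its minimizers -/

section Energy

lemma integrable_continuousMap (ν : Measure (S n)) [IsFiniteMeasure ν] (f : C(S n, ℝ)) :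
    Integrable f ν :=
  f.continuous.integrable_of_hasCompactSupport (HasCompactSupport.of_compactSpace f)

lemma integrable_of_continuous {ν : Measure (S n)} [IsFiniteMeasure ν] {f : S n → ℝ}
    (hf : Continuous f) : Integrable f ν :=
  integrable_continuousMap ν ⟨f, hf⟩

lemma continuous_integral_continuousMap (ν : Measure (S n)) [IsFiniteMeasure ν] :
    Continuous fun f : C(S n, ℝ) => ∫ v, f v ∂ν := by
  refine (LipschitzWith.of_dist_le_mul (K := (ν.real Set.univ).toNNReal) fun f g => ?_).continuous
  rw [dist_eq_norm, ← integral_sub (integrable_continuousMap ν f) (integrable_continuousMap ν g),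
    Real.coe_toNNReal _ measureReal_nonneg, mul_comm]
  refine norm_integral_le_of_norm_le_const (Eventually.of_forall fun v => ?_)
  rw [← dist_eq_norm]
  exact ContinuousMap.dist_apply_le_dist v

lemma isCompact_setOf_lipschitz (M L : ℝ) :
    IsCompact {φ : C(S n, ℝ) | (∀ v, φ v ∈ Set.Icc (-M) M) ∧
      ∀ u v, dist (φ u) (φ v) ≤ L * dist u v} := by
  refine ArzelaAscoli.isCompact_of_equicontinuous _ ?_ ?_
  · have himage : ContinuousMap.toFun '' {φ : C(S n, ℝ) | (∀ v, φ v ∈ Set.Icc (-M) M) ∧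
        ∀ u v, dist (φ u) (φ v) ≤ L * dist u v} = (Set.pi Set.univ fun _ => Set.Icc (-M) M) ∩
        ⋂ (u : S n) (v : S n), {f : S n → ℝ | dist (f u) (f v) ≤ L * dist u v} := by
      ext f
      constructor
      · rintro ⟨φ, ⟨h1, h2⟩, rfl⟩
        exact ⟨fun v _ => h1 v, Set.mem_iInter₂.2 h2⟩
      · rintro ⟨h1, h2⟩
        have h2' := Set.mem_iInter₂.1 h2
        refine ⟨⟨f, (LipschitzWith.of_dist_le' h2').continuous⟩,
          ⟨fun v => h1 v trivial, h2'⟩, rfl⟩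
    rw [himage]
    refine (isCompact_univ_pi fun _ => isCompact_Icc).inter_right ?_
    exact isClosed_iInter fun u => isClosed_iInter fun v =>
      isClosed_le (by fun_prop) continuous_const
  · refine (LipschitzWith.uniformEquicontinuous _ L.toNNReal fun φ => ?_).equicontinuous
    exact LipschitzWith.of_dist_le' φ.2.2

variable [Nonempty (S n)]

/-- The energy `∫ φ dμ + c ∫ exp (p φ*) dσ` with `φ*` the logarithmic conjugate of `φ`. For
`φ = log h_K`, it is `∫ log h_K dμ + c ∫ ρ_K ^ (-p) dσ`. -/
noncomputable def energy (μ σ : Measure (S n)) (p c : ℝ) (φ : C(S n, ℝ)) : ℝ :=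
  ∫ v, φ v ∂μ + c * ∫ u, exp (p * logConj φ u) ∂σ

lemma continuous_energy (μ σ : Measure (S n)) [IsFiniteMeasure μ] [IsFiniteMeasure σ] (p c : ℝ) :
    Continuous (energy μ σ p c) := by
  have h : Continuous fun φ : C(S n, ℝ) =>
      (⟨fun t => exp (p * t), by fun_prop⟩ : C(ℝ, ℝ)).comp (logConj φ) :=
    (ContinuousMap.continuous_postcomp _).comp lipschitzWith_logConj.continuous
  exact (continuous_integral_continuousMap μ).add
    (continuous_const.mul ((continuous_integral_continuousMap σ).comp h))

/-- Replacing `φ` by its double conjugate shrinks the first term and preserves the second. -/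
lemma energy_logConj_logConj_le (μ σ : Measure (S n)) [IsFiniteMeasure μ] (p c : ℝ)
    (φ : C(S n, ℝ)) : energy μ σ p c (logConj (logConj φ)) ≤ energy μ σ p c φ := by
  unfold energy
  rw [logConj_logConj_logConj]
  gcongr
  · exact integrable_continuousMap μ _
  · exact integrable_continuousMap μ _
  · exact fun v => logConj_logConj_le φ v

/-- If every open hemisphere has positive measure, then the moments of the positive parts
`(v · w)₊` are bounded below uniformly in `w`. -/
lemma exists_pos_le_integral_posPart (ν : Measure (S n)) [IsFiniteMeasure ν] {p : ℝ} (hp : 0 < p)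
    (h : ∀ w : S n, 0 < ν {v | 0 < (inner ℝ (v : E n) (w : E n) : ℝ)}) :
    ∃ m > 0, m ≤ ν.real Set.univ ∧
      ∀ w : S n, m ≤ ∫ v : S n, (max 0 (inner ℝ (v : E n) (w : E n))) ^ p ∂ν := by
  have hc : Continuous fun x : S n × S n =>
      (max 0 (inner ℝ (x.1 : E n) (x.2 : E n)) : ℝ) ^ p :=
    Continuous.rpow_const (by fun_prop) fun _ => Or.inr hp.le
  have hle : ∀ w v : S n, (max 0 (inner ℝ (v : E n) (w : E n)) : ℝ) ≤ 1 := fun w v =>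
    max_le zero_le_one
      (by simpa [norm_eq_of_mem_sphere] using real_inner_le_norm (v : E n) (w : E n))
  have hI : Continuous fun w : S n =>
      ∫ v : S n, (max 0 (inner ℝ (v : E n) (w : E n)) : ℝ) ^ p ∂ν := by
    refine continuous_of_dominated (bound := fun _ => 1) (fun w => ?_) (fun w => ?_)
      (integrable_const 1) (Eventually.of_forall fun v => ?_)
    · exact (hc.comp (by fun_prop : Continuous fun v : S n => (v, w))).aestronglyMeasurable
    · refine Eventually.of_forall fun v => ?_
      rw [norm_of_nonneg (by positivity)]
      exact rpow_le_one (le_max_left _ _) (hle w v) hp.le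
    · exact hc.comp (by fun_prop : Continuous fun w : S n => (v, w))
  obtain ⟨w₀, -, hw₀⟩ := isCompact_univ.exists_isMinOn Set.univ_nonempty hI.continuousOn
  have hint : Integrable (fun v : S n => (max 0 (inner ℝ (v : E n) (w₀ : E n)) : ℝ) ^ p) ν :=
    integrable_of_continuous (hc.comp (by fun_prop : Continuous fun v : S n => (v, w₀)))
  refine ⟨_, ?_, ?_, fun w => hw₀ (Set.mem_univ w)⟩
  swap
  · refine (integral_mono hint (integrable_const 1) fun v =>
      rpow_le_one (le_max_left _ _) (hle w₀ v) hp.le).trans ?_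
    simp
  refine (integral_pos_iff_support_of_nonneg (fun v => by positivity) hint).2 ?_
  refine (h w₀).trans_le (measure_mono fun v hv => ?_)
  have hv' : (0 : ℝ) < max 0 (inner ℝ (v : E n) (w₀ : E n)) := lt_max_of_lt_right hv
  exact (rpow_pos_of_pos hv' p).ne'

/-- With `a = -min ψ` and `b = max ψ` for a conjugate `ψ`, i.e. for `ψ = log h_K` with
`exp (-a)` and `exp b` the inner and outer radius of `K` about the origin, the energy controls
both `a` and `b`. -/
lemma exists_coercive_bound (μ σ : Measure (S n)) [IsFiniteMeasure μ] [IsFiniteMeasure σ]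
    {p c : ℝ} (hp : 0 < p) (hc : 0 < c)
    (hμ : ∀ w : S n, 0 < μ {v | 0 < (inner ℝ (v : E n) (w : E n) : ℝ)})
    (hσ : ∀ w : S n, 0 < σ {v | 0 < (inner ℝ (v : E n) (w : E n) : ℝ)}) :
    ∃ m > 0, m ≤ μ.real Set.univ ∧ ∃ k > 0, ∀ χ : C(S n, ℝ), ∃ a b : ℝ,
      (∀ v, -a ≤ logConj χ v) ∧ (∀ v, logConj χ v ≤ b) ∧ (∀ v, -χ v ≤ b) ∧
      m * (a + b) - μ.real Set.univ * (a + 1) + k * exp (p * a)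
        ≤ energy μ σ p c (logConj χ) := by
  obtain ⟨m, hm, hmM, hmμ⟩ := exists_pos_le_integral_posPart μ one_pos hμ
  obtain ⟨k, hk, -, hkσ⟩ := exists_pos_le_integral_posPart σ hp hσ
  refine ⟨m, hm, hmM, c * k, by positivity, fun χ => ?_⟩
  -- `u₀` is the direction of the outer radius `exp b`, and `v₀` that of the inner radius `exp (-a)`.
  obtain ⟨u₀, -, hu₀⟩ := isCompact_univ.exists_isMinOn Set.univ_nonempty χ.continuous.continuousOn
  obtain ⟨v₀, -, hv₀⟩ := isCompact_univ.exists_isMinOn Set.univ_nonempty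
    (logConj χ).continuous.continuousOn
  replace hu₀ : ∀ u, χ u₀ ≤ χ u := fun u => hu₀ (Set.mem_univ u)
  replace hv₀ : ∀ v, logConj χ v₀ ≤ logConj χ v := fun v => hv₀ (Set.mem_univ v)
  set ψ := logConj χ with hψ
  have hψb : ∀ v, ψ v ≤ -χ u₀ := fun v => by
    rw [hψ, logConj_le_iff]
    intro u
    have : (inner ℝ (v : E n) (u : E n) : ℝ) ≤ 1 := by
      simpa [norm_eq_of_mem_sphere] using real_inner_le_norm (v : E n) (u : E n)
    exact this.trans (one_le_exp (by linarith [hu₀ u]))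
  refine ⟨-ψ v₀, -χ u₀, fun v => by simpa using hv₀ v, hψb, fun v => by simpa using hu₀ v, ?_⟩
  set a := -ψ v₀ with ha
  set b := -χ u₀ with hb
  have hab : 0 ≤ a + b := by linarith [hψb v₀]
  have h1 : m * (a + b) - μ.real Set.univ * (a + 1) ≤ ∫ v, ψ v ∂μ := by
    -- The concavity estimate `log (max r (R s)) ≥ (1 - s) log r + s log R - 1` for `0 ≤ s ≤ 1`.
    have key : ∀ v : S n,
        (max 0 (inner ℝ (v : E n) (u₀ : E n)) : ℝ) ^ (1 : ℝ) * (a + b) - (a + 1) ≤ ψ v := by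
      intro v
      rw [rpow_one]
      rcases le_or_gt (inner ℝ (v : E n) (u₀ : E n) : ℝ) 0 with h | h
      · rw [max_eq_left h]; linarith [hv₀ v]
      · rw [max_eq_right h.le]
        set s : ℝ := inner ℝ (v : E n) (u₀ : E n)
        have hs1 : s ≤ 1 := by
          simpa [norm_eq_of_mem_sphere] using real_inner_le_norm (v : E n) (u₀ : E n)
        have h2 : log s ≤ χ u₀ + ψ v := by
          rw [log_le_iff_le_exp h]; exact inner_le_exp_add χ v u₀
        have h3 : s - 1 ≤ s * log s := by
          have := one_sub_inv_le_log_of_pos h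
          calc s - 1 = s * (1 - s⁻¹) := by field_simp
            _ ≤ s * log s := by gcongr
        have h4 : (1 - s) * (-a) ≤ (1 - s) * ψ v :=
          mul_le_mul_of_nonneg_left (by linarith [hv₀ v]) (by linarith)
        have h5 : s * (log s + b) ≤ s * ψ v :=
          mul_le_mul_of_nonneg_left (by linarith) h.le
        linarith
    have hcont : Continuous fun v : S n =>
        (max 0 (inner ℝ (v : E n) (u₀ : E n)) : ℝ) ^ (1 : ℝ) := by
      simp only [rpow_one]; fun_prop
    calc m * (a + b) - μ.real Set.univ * (a + 1)
        ≤ (∫ v : S n, (max 0 (inner ℝ (v : E n) (u₀ : E n)) : ℝ) ^ (1 : ℝ) ∂μ) * (a + b)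
          - μ.real Set.univ * (a + 1) := by gcongr; exact hmμ u₀
      _ = ∫ v : S n, ((max 0 (inner ℝ (v : E n) (u₀ : E n)) : ℝ) ^ (1 : ℝ) * (a + b)
          - (a + 1)) ∂μ := by
        rw [integral_sub ((integrable_of_continuous hcont).mul_const _) (integrable_const _),
          integral_mul_const, integral_const, smul_eq_mul]
      _ ≤ ∫ v, ψ v ∂μ := integral_mono (((integrable_of_continuous hcont).mul_const _).sub
          (integrable_const _)) (integrable_continuousMap μ ψ) key
  -- The body lies in the half-space `{x | x · v₀ ≤ exp (-a)}`, which bounds its radial function.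
  have h2 : k * exp (p * a) ≤ ∫ u, exp (p * logConj ψ u) ∂σ := by
    have key : ∀ u : S n,
        (max 0 (inner ℝ (u : E n) (v₀ : E n)) : ℝ) ^ p * exp (p * a) ≤ exp (p * logConj ψ u) := by
      intro u
      rcases le_or_gt (inner ℝ (u : E n) (v₀ : E n) : ℝ) 0 with h | h
      · rw [max_eq_left h, zero_rpow hp.ne', zero_mul]; positivity
      · rw [max_eq_right h.le, rpow_def_of_pos h, ← exp_add, exp_le_exp]
        have : log (inner ℝ (u : E n) (v₀ : E n)) ≤ ψ v₀ + logConj ψ u := by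
          rw [log_le_iff_le_exp h]; exact inner_le_exp_add ψ u v₀
        nlinarith
    have hcont : Continuous fun u : S n =>
        (max 0 (inner ℝ (u : E n) (v₀ : E n)) : ℝ) ^ p :=
      Continuous.rpow_const (by fun_prop) fun _ => Or.inr hp.le
    calc k * exp (p * a)
        ≤ (∫ u : S n, (max 0 (inner ℝ (u : E n) (v₀ : E n)) : ℝ) ^ p ∂σ) * exp (p * a) := by
          gcongr; exact hkσ v₀
      _ = ∫ u : S n, (max 0 (inner ℝ (u : E n) (v₀ : E n)) : ℝ) ^ p * exp (p * a) ∂σ := by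
          rw [integral_mul_const]
      _ ≤ _ := integral_mono ((integrable_of_continuous hcont).mul_const _)
          (integrable_of_continuous (by fun_prop)) key
  have h3 : c * (k * exp (p * a)) ≤ c * ∫ u, exp (p * logConj ψ u) ∂σ := by gcongr
  unfold energy
  linarith

/-- Sublevel sets of the lower bound for the energy are bounded. -/
lemma exists_bound_of_coercive {m k M p : ℝ} (hm : 0 < m) (hmM : m ≤ M) (hk : 0 < k) (hp : 0 < p)
    (C : ℝ) : ∃ B, 0 ≤ B ∧ ∀ a b : ℝ, 0 ≤ a + b →
      m * (a + b) - M * (a + 1) + k * exp (p * a) ≤ C → a ≤ B ∧ b ≤ B := by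
  have hlim : Tendsto (fun a : ℝ => k * exp (p * a) - M * a) atTop atTop := by
    have h1 : Tendsto (fun x : ℝ => exp x / x ^ 1) atTop atTop := tendsto_exp_div_pow_atTop 1
    have h2 : Tendsto (fun a : ℝ => p * a) atTop atTop := tendsto_id.const_mul_atTop hp
    have h3 := (tendsto_atTop_add_const_right _ (-M) ((h1.comp h2).const_mul_atTop
      (mul_pos hk hp))).atTop_mul_atTop₀ tendsto_id
    refine h3.congr' ?_
    filter_upwards [eventually_gt_atTop 0] with a ha
    simp only [Function.comp, id]
    field_simp
    ring
  obtain ⟨A, hA⟩ := (hlim.eventually_gt_atTop (C + M)).exists_forall_of_atTop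
  refine ⟨max (max A 0) ((C + M + (M - m) * A) / m), by positivity, fun a b hab h => ?_⟩
  have haA : a ≤ A := by
    by_contra! hlt
    have := hA a hlt.le
    nlinarith
  refine ⟨haA.trans ((le_max_left _ _).trans (le_max_left _ _)), le_max_of_le_right ?_⟩
  rw [le_div_iff₀ hm]
  nlinarith [exp_pos (p * a)]

/-- If `b` bounds `log R` with `R` the outer radius, and `-a` is a lower bound of `log h_K`, then
`log h_K` is Lipschitz with constant `exp (a + b)`. -/
lemma dist_logConj_le {χ : C(S n, ℝ)} {a b : ℝ} (ha : ∀ v, -a ≤ logConj χ v)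
    (hb : ∀ v, -χ v ≤ b) (u v : S n) :
    dist (logConj χ u) (logConj χ v) ≤ exp (a + b) * dist u v := by
  have key : ∀ u v : S n, logConj χ u - logConj χ v ≤ exp (a + b) * dist u v := by
    intro u v
    have h1 := wulffGauge_sub_le χ hb (u : E n) (v : E n)
    rw [← exp_logConj, ← exp_logConj, ← dist_eq_norm, ← Subtype.dist_eq] at h1
    have h2 := add_one_le_exp (logConj χ u - logConj χ v)
    have h3 : exp (-logConj χ v) ≤ exp a := exp_le_exp.2 (by linarith [ha v])
    calc logConj χ u - logConj χ v ≤ exp (logConj χ u - logConj χ v) - 1 := by linarith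
      _ = exp (-logConj χ v) * (exp (logConj χ u) - exp (logConj χ v)) := by
        rw [mul_sub, ← exp_add, ← exp_add]; simp [sub_eq_neg_add]
      _ ≤ exp (-logConj χ v) * (exp b * dist u v) := by gcongr
      _ ≤ exp a * (exp b * dist u v) := by gcongr
      _ = exp (a + b) * dist u v := by rw [exp_add]; ring
  rw [Real.dist_eq, abs_sub_le_iff]
  exact ⟨key u v, by rw [dist_comm]; exact key v u⟩

/-- The energy has a global minimizer that is its own double conjugate, i.e. the logarithm of the
support function of a convex body. -/
lemma exists_minimizer (μ σ : Measure (S n)) [IsFiniteMeasure μ] [IsFiniteMeasure σ]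
    {p c : ℝ} (hp : 0 < p) (hc : 0 < c)
    (hμ : ∀ w : S n, 0 < μ {v | 0 < (inner ℝ (v : E n) (w : E n) : ℝ)})
    (hσ : ∀ w : S n, 0 < σ {v | 0 < (inner ℝ (v : E n) (w : E n) : ℝ)}) :
    ∃ φ : C(S n, ℝ), logConj (logConj φ) = φ ∧ ∀ ψ, energy μ σ p c φ ≤ energy μ σ p c ψ := by
  obtain ⟨m, hm, hmM, k, hk, hcoer⟩ := exists_coercive_bound μ σ hp hc hμ hσ
  obtain ⟨B, hB0, hB⟩ := exists_bound_of_coercive hm hmM hk hp (energy μ σ p c 0)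
  have hcpt := isCompact_setOf_lipschitz (n := n) B (exp (B + B))
  set 𝒦 := {φ : C(S n, ℝ) | (∀ v, φ v ∈ Set.Icc (-B) B) ∧
      ∀ u v, dist (φ u) (φ v) ≤ exp (B + B) * dist u v} with h𝒦
  have h0 : (0 : C(S n, ℝ)) ∈ 𝒦 :=
    ⟨fun v => by simpa using hB0, fun u v => by simp; positivity⟩
  have hmem : ∀ ψ, energy μ σ p c ψ ≤ energy μ σ p c 0 → logConj (logConj ψ) ∈ 𝒦 := by
    intro ψ hψ
    obtain ⟨a, b, ha, hb, hχb, hab⟩ := hcoer (logConj ψ)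
    have hab0 : 0 ≤ a + b := by
      obtain ⟨v⟩ := ‹Nonempty (S n)›
      linarith [ha v, hb v]
    obtain ⟨haB, hbB⟩ := hB a b hab0
      (hab.trans ((energy_logConj_logConj_le μ σ p c ψ).trans hψ))
    exact ⟨fun v => ⟨by linarith [ha v], by linarith [hb v]⟩,
      dist_logConj_le (fun v => by linarith [ha v]) (fun v => by linarith [hχb v])⟩
  obtain ⟨φ, hφ𝒦, hφ⟩ := hcpt.exists_isMinOn ⟨0, h0⟩ (continuous_energy μ σ p c).continuousOn
  refine ⟨logConj (logConj φ), logConj_logConj_logConj _, fun ψ => ?_⟩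
  refine (energy_logConj_logConj_le μ σ p c φ).trans ?_
  rcases le_total (energy μ σ p c ψ) (energy μ σ p c 0) with h | h
  · exact (hφ (hmem ψ h)).trans (energy_logConj_logConj_le μ σ p c ψ)
  · exact (hφ h0).trans h

end Energy

/-! ### Uniqueness of the normal in almost every direction -/

section Normal

variable [Nonempty (S n)]

/-- `v` attains the supremum in the definition of `logConj φ u`: it is an outer normal of the Wulff
shape of `exp φ` at its boundary point in direction `u`. -/
def IsMaximizer (φ : C(S n, ℝ)) (u v : S n) : Prop :=
  inner ℝ (u : E n) (v : E n) = exp (φ v + logConj φ u)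

lemma isMaximizer_iff {φ : C(S n, ℝ)} {u v : S n} :
    IsMaximizer φ u v ↔ exp (-φ v) * inner ℝ (u : E n) (v : E n) = wulffGauge φ u := by
  unfold IsMaximizer
  rw [exp_add, exp_logConj]
  constructor <;> intro h
  · rw [h, ← mul_assoc, ← exp_add]; simp
  · rw [← h, ← mul_assoc, ← exp_add]; simp

open Classical in
/-- The normalization `x / ‖x‖` of a nonzero vector, with an arbitrary value at `0`. -/
noncomputable def unitDir (x : E n) : S n :=
  if h : x ∈ ({0}ᶜ : Set (E n)) then
    ⟨‖x‖⁻¹ • x, by simp [norm_smul, inv_mul_cancel₀ (norm_ne_zero_iff.2 h)]⟩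
  else Classical.arbitrary _

lemma measurable_unitDir : Measurable (unitDir : E n → S n) := by
  classical
  exact Measurable.dite (s := ({0}ᶜ : Set (E n)))
    (f := fun x => (⟨‖x.1‖⁻¹ • x.1, by
      simp [norm_smul, inv_mul_cancel₀ (norm_ne_zero_iff.2 x.2)]⟩ : S n))
    (Measurable.subtype_mk (h := fun x => by
      simp [norm_smul, inv_mul_cancel₀ (norm_ne_zero_iff.2 x.2)]) (by fun_prop))
    measurable_const (measurableSet_singleton 0).compl

lemma unitDir_smul {t : ℝ} (ht : 0 < t) (v : S n) : unitDir (t • (v : E n)) = v := by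
  have hv : ‖(v : E n)‖ = 1 := norm_eq_of_mem_sphere v
  have hne : t • (v : E n) ∈ ({0}ᶜ : Set (E n)) := by
    simp [ht.ne', norm_ne_zero_iff.1 (hv.trans_ne one_ne_zero)]
  rw [unitDir, dif_pos hne]
  ext1
  change ‖t • (v : E n)‖⁻¹ • t • (v : E n) = v
  rw [norm_smul, hv, norm_of_nonneg ht.le, mul_one, smul_smul, inv_mul_cancel₀ ht.ne', one_smul]

/-- The normalized gradient of the gauge. Where the gauge is differentiable, this is the unique
outer unit normal of the Wulff shape at its boundary point in direction `u`. -/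
noncomputable def gaugeNormal (φ : C(S n, ℝ)) (u : S n) : S n :=
  unitDir (gradient (wulffGauge φ) (u : E n))

lemma measurable_gaugeNormal (φ : C(S n, ℝ)) : Measurable (gaugeNormal φ) := by
  have h : Measurable (gradient (wulffGauge φ)) :=
    (InnerProductSpace.toDual ℝ (E n)).symm.continuous.measurable.comp (measurable_fderiv ℝ _)
  exact measurable_unitDir.comp (h.comp measurable_subtype_coe)

/-- A maximizing `v` supports the gauge from below at `u`, so its multiple `exp (-φ v) v` is the
gradient there. -/
lemma IsMaximizer.eq_gaugeNormal {φ : C(S n, ℝ)} {u v : S n} (h : IsMaximizer φ u v)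
    (hd : DifferentiableAt ℝ (wulffGauge φ) (u : E n)) : v = gaugeNormal φ u := by
  rw [isMaximizer_iff] at h
  have hmin : IsLocalMin (fun x : E n => wulffGauge φ x - inner ℝ (exp (-φ v) • (v : E n)) x)
      (u : E n) := by
    refine Eventually.of_forall fun x => ?_
    have := le_wulffGauge φ x v
    simp only [real_inner_smul_left, real_inner_comm (v : E n)] at *
    rw [real_inner_comm (u : E n)] at *
    linarith
  have hg := (hd.hasGradientAt.hasFDerivAt).sub
    (innerSL ℝ (exp (-φ v) • (v : E n))).hasFDerivAt
  have h0 := hmin.hasFDerivAt_eq_zero hg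
  have hgrad : gradient (wulffGauge φ) (u : E n) = exp (-φ v) • (v : E n) := by
    refine ext_inner_right ℝ fun x => ?_
    have := congrArg (fun L => L x) h0
    simpa [sub_eq_zero, real_inner_smul_left] using this
  rw [gaugeNormal, hgrad, unitDir_smul (exp_pos _)]

lemma exists_isMaximizer (φ : C(S n, ℝ)) (u : S n) : ∃ v, IsMaximizer φ u v :=
  exists_inner_eq_exp_add φ u

lemma isMaximizer_iff_of_differentiableAt {φ : C(S n, ℝ)} {u : S n}
    (hd : DifferentiableAt ℝ (wulffGauge φ) (u : E n)) (v : S n) :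
    IsMaximizer φ u v ↔ v = gaugeNormal φ u := by
  refine ⟨fun h => h.eq_gaugeNormal hd, ?_⟩
  rintro rfl
  obtain ⟨w, hw⟩ := exists_isMaximizer φ u
  rwa [← hw.eq_gaugeNormal hd]

/-- Rademacher's theorem passes to the sphere since the gauge is positively homogeneous. -/
lemma ae_differentiableAt_wulffGauge (φ : C(S n, ℝ)) :
    ∀ᵐ u ∂sphericalMeasure n, DifferentiableAt ℝ (wulffGauge φ) ((u : S n) : E n) := by
  have hmeas : MeasurableSet {u : S n | ¬ DifferentiableAt ℝ (wulffGauge φ) (u : E n)} :=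
    ((measurableSet_of_differentiableAt ℝ (wulffGauge φ)).preimage measurable_subtype_coe).compl
  rw [ae_iff, sphericalMeasure, Measure.toSphere_apply' _ hmeas, mul_eq_zero]
  right
  refine measure_mono_null ?_ (ae_iff.1
    (lipschitzWith_wulffGauge φ (neg_le_norm φ)).ae_differentiableAt)
  rintro _ ⟨t, ht, _, ⟨u, hu, rfl⟩, rfl⟩ hd
  refine hu ?_
  have heq : wulffGauge φ = fun x => t⁻¹ * wulffGauge φ (t • x) := by
    ext x
    rw [wulffGauge_smul φ ht.1.le, inv_mul_cancel_left₀ ht.1.ne']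
  rw [heq]
  refine DifferentiableAt.const_mul ?_ _
  exact DifferentiableAt.comp (u : E n) (g := wulffGauge φ) hd (by fun_prop)

end Normal

/-! ### The first variation of the energy -/

section FirstVariation

variable [Nonempty (S n)]

/-- Envelope theorem: in a direction with a unique maximizer `v`, the derivative of the conjugate
along `g` is `-g v`. -/
lemma hasDerivAt_logConj (φ g : C(S n, ℝ)) {u v : S n}
    (huniq : ∀ w, IsMaximizer φ u w ↔ w = v) :
    HasDerivAt (fun t : ℝ => logConj (φ + t • g) u) (-g v) 0 := by
  choose w hw using fun t : ℝ => exists_isMaximizer (φ + t • g) u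
  have hv : IsMaximizer φ u v := (huniq v).2 rfl
  -- `w t` is an almost maximizer for `φ`, so that its only cluster point is `v`.
  have hval : ∀ t, exp (-φ (w t)) * inner ℝ (u : E n) (w t : E n)
      = exp (t * g (w t) + logConj (φ + t • g) u) := fun t => by
    rw [(hw t : _ = _), ← exp_add]; congr 1; simp; ring
  have hlow : ∀ t, -t * g v ≤ logConj (φ + t • g) u - logConj φ u := fun t => by
    have := inner_le_exp_add (φ + t • g) u v
    rw [(hv : _ = _), exp_le_exp] at this
    simp at this; linarith
  have hup : ∀ t, logConj (φ + t • g) u - logConj φ u ≤ -t * g (w t) := fun t => by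
    have := inner_le_exp_add φ u (w t)
    rw [(hw t : _ = _), exp_le_exp] at this
    simp at this; linarith
  have hbd : ∀ t : ℝ, ∀ x : S n, |t * g x| ≤ |t| * ‖g‖ := fun t x => by
    rw [abs_mul]; gcongr; exact g.norm_coe_le_norm x
  have hlim : Tendsto (fun t => exp (-φ (w t)) * inner ℝ (u : E n) (w t : E n)) (𝓝 0)
      (𝓝 (wulffGauge φ u)) := by
    simp_rw [hval]
    rw [← exp_logConj]
    refine (continuous_exp.tendsto _).comp ?_
    rw [tendsto_iff_dist_tendsto_zero]
    refine squeeze_zero (fun _ => dist_nonneg) (g := fun t : ℝ => 2 * (|t| * ‖g‖)) (fun t => ?_) ?_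
    · have h1 := abs_le.1 (hbd t v)
      have h2 := abs_le.1 (hbd t (w t))
      rw [Real.dist_eq, abs_le]
      constructor <;> linarith [hlow t, hup t]
    · have : Continuous fun t : ℝ => 2 * (|t| * ‖g‖) := by fun_prop
      simpa using this.tendsto 0
  have hwlim : Tendsto w (𝓝 0) (𝓝 v) := by
    refine tendsto_nhds_of_unique_mapClusterPt fun x hx => ?_
    rw [← huniq, isMaximizer_iff]
    have hcont : Continuous fun x : S n => exp (-φ x) * inner ℝ (u : E n) (x : E n) := by fun_prop
    have hcl := hx.continuousAt_comp hcont.continuousAt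
    exact eq_of_nhds_neBot (NeBot.mono hcl (inf_le_inf_left _ hlim))
  rw [hasDerivAt_iff_isLittleO]
  have hg0 : Tendsto (fun t => g v - g (w t)) (𝓝 0) (𝓝 0) := by
    simpa using (tendsto_const_nhds (x := g v)).sub ((g.continuous.tendsto v).comp hwlim)
  rw [Asymptotics.isLittleO_iff]
  intro ε hε
  filter_upwards [(tendsto_order.1 hg0.norm).2 ε (by simpa using hε)] with t ht
  simp only [zero_smul, add_zero, sub_zero, smul_eq_mul]
  have h1 := hlow t
  have h2 := hup t
  have h3 : t * (g v - g (w t)) ≤ ε * ‖t‖ := by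
    calc _ ≤ ‖t * (g v - g (w t))‖ := le_norm_self _
      _ ≤ _ := by rw [norm_mul, mul_comm]; gcongr
  rw [Real.norm_eq_abs, abs_le]
  constructor
  · have : 0 ≤ ε * ‖t‖ := by positivity
    linarith
  · linarith

lemma abs_exp_sub_exp_le {x y B : ℝ} (hx : x ≤ B) (hy : y ≤ B) :
    |exp x - exp y| ≤ exp B * |x - y| := by
  have key : ∀ x y : ℝ, x ≤ B → exp x - exp y ≤ exp B * |x - y| := fun x y hx => by
    have h1 := add_one_le_exp (y - x)
    calc exp x - exp y = exp x * (1 - exp (y - x)) := by rw [mul_sub, ← exp_add]; simp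
      _ ≤ exp x * |x - y| := by gcongr; linarith [le_abs_self (x - y)]
      _ ≤ exp B * |x - y| := by gcongr
  rw [abs_sub_le_iff]
  exact ⟨key x y hx, by rw [abs_sub_comm]; exact key y x hy⟩

lemma hasDerivAt_energy (μ : Measure (S n)) [IsFiniteMeasure μ] {p : ℝ} (hp : 0 < p) (c : ℝ)
    (φ g : C(S n, ℝ)) :
    HasDerivAt (fun t : ℝ => energy μ (sphericalMeasure n) p c (φ + t • g))
      (∫ v, g v ∂μ + c * ∫ u, exp (p * logConj φ u) * (p * -g (gaugeNormal φ u))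
        ∂sphericalMeasure n) 0 := by
  have : IsFiniteMeasure (sphericalMeasure n) := by unfold sphericalMeasure; infer_instance
  have hlin : HasDerivAt (fun t : ℝ => ∫ v, (φ + t • g) v ∂μ) (∫ v, g v ∂μ) 0 := by
    have : (fun t : ℝ => ∫ v, (φ + t • g) v ∂μ) = fun t => ∫ v, φ v ∂μ + t * ∫ v, g v ∂μ := by
      ext t
      rw [← integral_const_mul, ← integral_add (integrable_continuousMap μ φ)
        ((integrable_continuousMap μ g).const_mul t)]
      simp
    rw [this]
    simpa using ((hasDerivAt_id (0 : ℝ)).mul_const (∫ v, g v ∂μ)).const_add (∫ v, φ v ∂μ)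
  refine hlin.add (HasDerivAt.const_mul c ?_)
  have hdist : ∀ s t : ℝ, ∀ u, |logConj (φ + s • g) u - logConj (φ + t • g) u|
      ≤ ‖g‖ * |s - t| := fun s t u => by
    have h1 := lipschitzWith_logConj.dist_le_mul (φ + s • g) (φ + t • g)
    have h2 := ContinuousMap.dist_apply_le_dist (f := logConj (φ + s • g))
      (g := logConj (φ + t • g)) u
    rw [dist_add_left, dist_eq_norm (s • g), ← sub_smul, norm_smul, NNReal.coe_one, one_mul] at h1
    rw [Real.dist_eq] at h2
    exact h2.trans (h1.trans_eq (mul_comm _ _))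
  set K : ℝ := exp (p * (‖logConj φ‖ + ‖g‖)) * (p * ‖g‖) with hK
  refine (hasDerivAt_integral_of_dominated_loc_of_lip (s := Metric.ball 0 1)
    (bound := fun _ => K) (F := fun (t : ℝ) (u : S n) => exp (p * logConj (φ + t • g) u))
    (Metric.ball_mem_nhds _ one_pos) (Eventually.of_forall fun t => ?_)
    (integrable_of_continuous (by fun_prop)) ?_ (Eventually.of_forall fun u => ?_)
    (integrable_const K) ?_).2
  · exact Continuous.aestronglyMeasurable (by fun_prop)
  · refine Measurable.aestronglyMeasurable ?_
    have := (map_continuous g).measurable.comp (measurable_gaugeNormal φ)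
    have h2 := (logConj φ).continuous.measurable
    exact ((h2.const_mul p).exp).mul ((this.neg).const_mul p)
  · refine LipschitzOnWith.of_dist_le_mul fun s hs t ht => ?_
    have hb : ∀ s ∈ Metric.ball (0 : ℝ) 1,
        p * logConj (φ + s • g) u ≤ p * (‖logConj φ‖ + ‖g‖) := fun s hs => by
      have h1 := (abs_le.1 (hdist s 0 u)).2
      have h2 := (le_abs_self _).trans ((logConj φ).norm_coe_le_norm u)
      have h3 : |s - 0| ≤ 1 := by
        simpa [Real.dist_eq] using (Metric.mem_ball.1 hs).le
      have h4 : ‖g‖ * |s - 0| ≤ ‖g‖ := mul_le_of_le_one_right (norm_nonneg g) h3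
      simp only [zero_smul, add_zero] at h1
      gcongr
      linarith
    rw [Real.dist_eq, Real.dist_eq, Real.coe_nnabs]
    calc _ ≤ exp (p * (‖logConj φ‖ + ‖g‖)) *
          |p * logConj (φ + s • g) u - p * logConj (φ + t • g) u| :=
          abs_exp_sub_exp_le (hb s hs) (hb t ht)
      _ ≤ exp (p * (‖logConj φ‖ + ‖g‖)) * (p * (‖g‖ * |s - t|)) := by
          rw [← mul_sub, abs_mul, abs_of_pos hp]
          gcongr
          exact hdist s t u
      _ = K * |s - t| := by rw [hK]; ring
      _ ≤ |K| * |s - t| := by gcongr; exact le_abs_self K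
  · filter_upwards [ae_differentiableAt_wulffGauge φ] with u hu
    have h1 := hasDerivAt_logConj φ g (isMaximizer_iff_of_differentiableAt hu)
    simpa using (h1.const_mul p).exp

/-- The Euler-Lagrange equation of the energy. -/
lemma integral_eq_of_minimizer (μ : Measure (S n)) [IsFiniteMeasure μ] {p c : ℝ} (hp : 0 < p)
    {φ : C(S n, ℝ)} (hφ : ∀ ψ, energy μ (sphericalMeasure n) p c φ
      ≤ energy μ (sphericalMeasure n) p c ψ) (g : C(S n, ℝ)) :
    ∫ v, g v ∂μ = c * p * ∫ u, exp (p * logConj φ u) * g (gaugeNormal φ u)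
      ∂sphericalMeasure n := by
  have hmin : IsLocalMin (fun t : ℝ => energy μ (sphericalMeasure n) p c (φ + t • g)) 0 :=
    Eventually.of_forall fun t => by simpa using hφ (φ + t • g)
  have h0 := hmin.hasDerivAt_eq_zero (hasDerivAt_energy μ hp c φ g)
  have h1 : ∀ u, exp (p * logConj φ u) * (p * -g (gaugeNormal φ u))
      = -p * (exp (p * logConj φ u) * g (gaugeNormal φ u)) := fun u => by ring
  simp_rw [h1] at h0
  rw [integral_const_mul] at h0
  linarith

end FirstVariation

/-! ### Dual curvature measures of Wulff shapes -/

lemma mem_reverseRadialGaussImage_iff {K : ConvexBody (E n)} {η : Set (S n)} {u : S n} :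
    u ∈ reverseRadialGaussImage K η ↔
      ∃ v ∈ η, IsOuterUnitNormal K (radialFn K u • (u : E n)) v := by
  constructor
  · rintro ⟨v, ⟨u', rfl, hv⟩, hvη⟩
    exact ⟨v, hvη, hv⟩
  · rintro ⟨v, hvη, hv⟩
    exact ⟨v, ⟨u, rfl, hv⟩, hvη⟩

instance : IsFiniteMeasure (sphericalMeasure n) := by unfold sphericalMeasure; infer_instance

section WulffShape

/-- The Wulff shape `{x | ∀ v, x · v ≤ exp (φ v)}` of `exp φ`. -/
noncomputable def wulffShape (φ : C(S n, ℝ)) : ConvexBody (E n) where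
  carrier := {x | ∀ v : S n, inner ℝ x (v : E n) ≤ exp (φ v)}
  convex' := by
    have : {x : E n | ∀ v : S n, inner ℝ x (v : E n) ≤ exp (φ v)}
        = ⋂ v : S n, {x : E n | inner ℝ x (v : E n) ≤ exp (φ v)} := by ext; simp
    rw [this]
    refine convex_iInter fun v => ?_
    exact convex_halfSpace_le ⟨fun x y => inner_add_left x y _,
      fun c x => real_inner_smul_left x _ c⟩ _
  isCompact' := by
    refine Metric.isCompact_of_isClosed_isBounded ?_ ?_
    · have : {x : E n | ∀ v : S n, inner ℝ x (v : E n) ≤ exp (φ v)}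
          = ⋂ v : S n, {x : E n | inner ℝ x (v : E n) ≤ exp (φ v)} := by ext; simp
      rw [this]
      exact isClosed_iInter fun v => isClosed_le (by fun_prop) continuous_const
    · refine (Metric.isBounded_closedBall (x := (0 : E n)) (r := exp ‖φ‖)).subset fun x hx => ?_
      rw [mem_closedBall_zero_iff]
      rcases eq_or_ne x 0 with rfl | h0
      · simp [exp_nonneg]
      have hn : ‖‖x‖⁻¹ • x‖ = 1 := by
        rw [norm_smul, norm_inv, norm_norm, inv_mul_cancel₀ (norm_ne_zero_iff.2 h0)]
      have := hx ⟨‖x‖⁻¹ • x, by simp [hn]⟩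
      rw [real_inner_smul_right, real_inner_self_eq_norm_sq, pow_two,
        inv_mul_cancel_left₀ (norm_ne_zero_iff.2 h0)] at this
      exact this.trans (exp_le_exp.2 ((le_abs_self _).trans (φ.norm_coe_le_norm _)))
  nonempty' := ⟨0, fun v => by simp [exp_nonneg]⟩

lemma mem_wulffShape {φ : C(S n, ℝ)} {x : E n} :
    x ∈ wulffShape φ ↔ ∀ v : S n, inner ℝ x (v : E n) ≤ exp (φ v) := Iff.rfl

variable [Nonempty (S n)]

lemma mem_wulffShape_iff_wulffGauge_le {φ : C(S n, ℝ)} {x : E n} :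
    x ∈ wulffShape φ ↔ wulffGauge φ x ≤ 1 := by
  have h : ∀ v : S n, exp (-φ v) * inner ℝ x (v : E n) ≤ 1 ↔ inner ℝ x (v : E n) ≤ exp (φ v) :=
    fun v => by rw [exp_neg, inv_mul_le_iff₀ (exp_pos _), mul_one]
  rw [mem_wulffShape]
  constructor
  · exact fun hx => ciSup_le fun v => (h v).2 (hx v)
  · exact fun hx v => (h v).1 ((le_wulffGauge φ x v).trans hx)

lemma zero_mem_interior_wulffShape (φ : C(S n, ℝ)) :
    (0 : E n) ∈ interior (wulffShape φ : Set (E n)) := by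
  have hopen : IsOpen {x : E n | wulffGauge φ x < 1} :=
    isOpen_lt (continuous_wulffGauge φ) continuous_const
  refine interior_maximal (fun x (hx : wulffGauge φ x < 1) =>
    mem_wulffShape_iff_wulffGauge_le.2 hx.le) hopen ?_
  change wulffGauge φ 0 < 1
  have := wulffGauge_smul φ le_rfl (0 : E n)
  simp only [zero_mul, smul_zero] at this
  simp [this]

lemma radialFn_wulffShape (φ : C(S n, ℝ)) (u : S n) :
    radialFn (wulffShape φ) u = exp (-logConj φ u) := by
  have hset : {r : ℝ | 0 < r ∧ r • (u : E n) ∈ wulffShape φ} = Set.Ioc 0 (exp (-logConj φ u)) := by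
    ext r
    refine and_congr_right fun hr => ?_
    rw [mem_wulffShape_iff_wulffGauge_le, wulffGauge_smul φ hr.le, ← exp_logConj, exp_neg,
      ← le_div_iff₀ (exp_pos _), one_div]
  rw [radialFn, hset, csSup_Ioc (exp_pos _)]

lemma supportFn_wulffShape {φ : C(S n, ℝ)} (hφ : logConj (logConj φ) = φ) (v : S n) :
    supportFn (wulffShape φ) v = exp (φ v) := by
  obtain ⟨u, hu⟩ := exists_inner_eq_exp_add (logConj φ) v
  rw [hφ] at hu
  refine IsGreatest.csSup_eq ⟨⟨exp (-logConj φ u) • (u : E n), ?_, ?_⟩, ?_⟩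
  · change _ ∈ wulffShape φ
    rw [mem_wulffShape_iff_wulffGauge_le, wulffGauge_smul φ (exp_nonneg _), ← exp_logConj,
      ← exp_add]
    simp
  · change (inner ℝ (v : E n) (exp (-logConj φ u) • (u : E n)) : ℝ) = _
    rw [real_inner_smul_right, hu, ← exp_add]
    congr 1; ring
  · rintro _ ⟨x, hx, rfl⟩
    change (inner ℝ (v : E n) x : ℝ) ≤ _
    rw [real_inner_comm]
    exact hx v

lemma isOuterUnitNormal_wulffShape_iff {φ : C(S n, ℝ)} (hφ : logConj (logConj φ) = φ)
    (u v : S n) :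
    IsOuterUnitNormal (wulffShape φ) (radialFn (wulffShape φ) u • (u : E n)) v ↔
      IsMaximizer φ u v := by
  rw [IsOuterUnitNormal, IsMaximizer, radialFn_wulffShape, supportFn_wulffShape hφ,
    real_inner_smul_left, exp_neg, inv_mul_eq_iff_eq_mul₀ (exp_pos _).ne', exp_add, mul_comm]

/-- The dual curvature measure of a Wulff shape is the push-forward of the measure
`ρ ^ q / n` on directions under the almost everywhere defined normal map. -/
lemma dualCurvatureMeasure_wulffShape (q : ℝ) {φ : C(S n, ℝ)} (hφ : logConj (logConj φ) = φ)
    {η : Set (S n)} (hη : MeasurableSet η) :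
    dualCurvatureMeasure q (wulffShape φ) η = (n : ℝ≥0∞)⁻¹ *
      Measure.map (gaugeNormal φ) ((sphericalMeasure n).withDensity
        fun u => ENNReal.ofReal (exp (-q * logConj φ u))) η := by
  rw [dualCurvatureMeasure, Measure.map_apply (measurable_gaugeNormal φ) hη,
    withDensity_apply _ (measurable_gaugeNormal φ hη)]
  have hset : reverseRadialGaussImage (wulffShape φ) η =ᵐ[sphericalMeasure n]
      gaugeNormal φ ⁻¹' η := by
    filter_upwards [ae_differentiableAt_wulffGauge φ] with u hu
    refine propext ?_
    change u ∈ reverseRadialGaussImage (wulffShape φ) η ↔ gaugeNormal φ u ∈ η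
    rw [mem_reverseRadialGaussImage_iff]
    simp_rw [isOuterUnitNormal_wulffShape_iff hφ, isMaximizer_iff_of_differentiableAt hu]
    simp
  rw [setLIntegral_congr hset]
  congr 2
  ext u
  rw [radialFn_wulffShape, ← exp_mul]
  congr 2; ring

end WulffShape

/-! ### Existence -/

lemma sphericalMeasure_pos_of_isOpen {U : Set (S n)} (hU : IsOpen U) (hne : U.Nonempty) :
    0 < sphericalMeasure n U := by
  have : (sphericalMeasure n).IsOpenPosMeasure := by unfold sphericalMeasure; infer_instance
  exact hU.measure_pos _ hne

theorem exists_dualCurvatureMeasure_eq [Nonempty (S n)] (hn : n ≠ 0) {q : ℝ} (hq : q < 0)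
    (μ : Measure (S n)) [IsFiniteMeasure μ]
    (hμ : ∀ w : S n, ¬ ConcentratedIn μ (closedHemisphere w)) :
    ∃ K : ConvexBody (E n), (0 : E n) ∈ interior (K : Set (E n)) ∧
      ∀ η : Set (S n), MeasurableSet η → μ η = dualCurvatureMeasure q K η := by
  have hn0 : (0 : ℝ) < n := by exact_mod_cast Nat.pos_of_ne_zero hn
  have hμ' : ∀ w : S n, 0 < μ {v | 0 < (inner ℝ (v : E n) (w : E n) : ℝ)} := fun w => by
    have h : {v : S n | 0 < (inner ℝ (v : E n) (w : E n) : ℝ)} = (closedHemisphere (-w))ᶜ := by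
      ext v; simp [closedHemisphere]
    rw [h]
    exact pos_iff_ne_zero.2 (hμ (-w))
  have hσ : ∀ w : S n, 0 < sphericalMeasure n {v | 0 < (inner ℝ (v : E n) (w : E n) : ℝ)} :=
    fun w => sphericalMeasure_pos_of_isOpen (isOpen_lt continuous_const (by fun_prop))
      ⟨w, by simp⟩
  obtain ⟨φ, hφ, hmin⟩ := exists_minimizer μ (sphericalMeasure n) (p := -q) (c := 1 / (-q * n))
    (by linarith) (one_div_pos.2 (mul_pos (by linarith) hn0)) hμ' hσ
  refine ⟨wulffShape φ, zero_mem_interior_wulffShape φ, fun η hη => ?_⟩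
  rw [dualCurvatureMeasure_wulffShape q hφ hη]
  have hcont : Continuous fun u => exp (-q * logConj φ u) := by fun_prop
  have hfin : IsFiniteMeasure ((sphericalMeasure n).withDensity
      fun u => ENNReal.ofReal (exp (-q * logConj φ u))) :=
    isFiniteMeasure_withDensity_ofReal (integrable_of_continuous hcont).2
  set ν := (sphericalMeasure n).withDensity fun u => ENNReal.ofReal (exp (-q * logConj φ u))
    with hν
  have key : μ = (n : ENNReal)⁻¹ • Measure.map (gaugeNormal φ) ν := by
    have : IsFiniteMeasure ((n : ENNReal)⁻¹ • Measure.map (gaugeNormal φ) ν) :=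
      Measure.smul_finite _ (by simpa using hn)
    refine ext_of_forall_integral_eq_of_IsFiniteMeasure fun g => ?_
    rw [integral_smul_measure, integral_map (measurable_gaugeNormal φ).aemeasurable
      g.continuous.aestronglyMeasurable, hν,
      integral_withDensity_eq_integral_toReal_smul hcont.measurable.ennreal_ofReal
        (Eventually.of_forall fun _ => ENNReal.ofReal_lt_top)]
    have h := integral_eq_of_minimizer μ (by linarith) hmin g.toContinuousMap
    simp only [ENNReal.toReal_ofReal (exp_nonneg _), smul_eq_mul, ENNReal.toReal_inv,
      ENNReal.toReal_natCast]
    have hc : 1 / (-q * n) * -q = (n : ℝ)⁻¹ := by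
      rw [one_div, mul_inv, mul_right_comm, inv_mul_cancel₀ (by linarith), one_mul]
    rw [hc] at h
    exact h
  conv_lhs => rw [key]
  rw [Measure.smul_apply, smul_eq_mul]

/-! ### Necessity -/

section Necessity

variable (K : ConvexBody (E n))

lemma bddAbove_radial (u : S n) : BddAbove {r : ℝ | 0 < r ∧ r • (u : E n) ∈ K} := by
  obtain ⟨R, hR⟩ := K.isBounded.subset_closedBall (0 : E n)
  refine ⟨R, fun r hr => ?_⟩
  have := hR hr.2
  rw [mem_closedBall_zero_iff, norm_smul, norm_eq_of_mem_sphere, mul_one] at this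
  exact (le_abs_self r).trans this

lemma inner_le_supportFn {x : E n} (hx : x ∈ K) (v : S n) :
    inner ℝ (v : E n) x ≤ supportFn K v :=
  le_csSup (K.isCompact.image (by fun_prop)).bddAbove ⟨x, hx, rfl⟩

variable {K}

lemma exists_ball_subset (hK : (0 : E n) ∈ interior (K : Set (E n))) :
    ∃ r > 0, ∀ x : E n, ‖x‖ ≤ r → x ∈ K := by
  obtain ⟨r, hr, h⟩ := Metric.nhds_basis_closedBall.mem_iff.1 (mem_interior_iff_mem_nhds.1 hK)
  exact ⟨r, hr, fun x hx => h (by simpa using hx)⟩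

lemma radialFn_pos (hK : (0 : E n) ∈ interior (K : Set (E n))) (u : S n) : 0 < radialFn K u := by
  obtain ⟨r, hr, h⟩ := exists_ball_subset hK
  exact hr.trans_le (le_csSup (bddAbove_radial K u)
    ⟨hr, h _ (by simp [norm_smul, abs_of_pos hr])⟩)

lemma radialFn_smul_mem (hK : (0 : E n) ∈ interior (K : Set (E n))) (u : S n) :
    radialFn K u • (u : E n) ∈ K := by
  have hpos := radialFn_pos hK u
  have hne : {r : ℝ | 0 < r ∧ r • (u : E n) ∈ K}.Nonempty := by
    obtain ⟨r, hr, h⟩ := exists_ball_subset hK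
    exact ⟨r, hr, h _ (by simp [norm_smul, abs_of_pos hr])⟩
  have hcl : IsClosed {r : ℝ | r • (u : E n) ∈ (K : Set (E n))} :=
    K.isClosed.preimage (by fun_prop)
  have hsub : closure {r : ℝ | 0 < r ∧ r • (u : E n) ∈ K} ⊆
      {r : ℝ | r • (u : E n) ∈ (K : Set (E n))} := hcl.closure_subset_iff.2 fun r hr => hr.2
  exact hsub (csSup_mem_closure hne (bddAbove_radial K u))

/-- A supporting hyperplane at the boundary point in direction `u`. -/
lemma exists_isOuterUnitNormal (hK : (0 : E n) ∈ interior (K : Set (E n))) (u : S n) :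
    ∃ v : S n, IsOuterUnitNormal K (radialFn K u • (u : E n)) v := by
  set x := radialFn K u • (u : E n) with hx
  have hpos := radialFn_pos hK u
  have hnot : x ∉ interior (K : Set (E n)) := by
    intro hmem
    have hopen : {r : ℝ | r • (u : E n) ∈ interior (K : Set (E n))} ∈ 𝓝 (radialFn K u) :=
      (isOpen_interior.preimage (by fun_prop : Continuous fun r : ℝ => r • (u : E n))).mem_nhds hmem
    obtain ⟨ε, hε, hball⟩ := Metric.mem_nhds_iff.1 hopen
    have h2 : radialFn K u + ε / 2 ∈ Metric.ball (radialFn K u) ε := by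
      rw [Metric.mem_ball, Real.dist_eq, add_sub_cancel_left, abs_of_pos (by linarith)]; linarith
    have h3 : radialFn K u + ε / 2 ≤ radialFn K u :=
      le_csSup (bddAbove_radial K u) ⟨by linarith, interior_subset (hball h2)⟩
    linarith
  obtain ⟨f, hf⟩ := geometric_hahn_banach_open_point K.convex.interior isOpen_interior hnot
  have hfx : 0 < f x := by simpa using hf 0 hK
  have hle : ∀ y ∈ K, f y ≤ f x := by
    have hsub : closure (interior (K : Set (E n))) ⊆ {y | f y ≤ f x} :=
      (isClosed_le (by fun_prop) continuous_const).closure_subset_iff.2 fun y hy => (hf y hy).le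
    rw [K.convex.closure_interior_eq_closure_of_nonempty_interior ⟨0, hK⟩,
      K.isClosed.closure_eq] at hsub
    exact hsub
  set z := (InnerProductSpace.toDual ℝ (E n)).symm f with hz
  have hfz : ∀ y, f y = inner ℝ z y := fun y => (InnerProductSpace.toDual_symm_apply).symm
  have hz0 : z ≠ 0 := by
    intro h
    rw [hfz, h, inner_zero_left] at hfx
    exact hfx.false
  have hzn : 0 < ‖z‖ := norm_pos_iff.2 hz0
  refine ⟨⟨‖z‖⁻¹ • z, by simp [norm_smul, inv_mul_cancel₀ hzn.ne']⟩, ?_⟩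
  refine Eq.symm (IsGreatest.csSup_eq ⟨⟨x, radialFn_smul_mem hK u, real_inner_comm _ _⟩, ?_⟩)
  rintro _ ⟨y, hy, rfl⟩
  change (inner ℝ (‖z‖⁻¹ • z) y : ℝ) ≤ inner ℝ x (‖z‖⁻¹ • z)
  rw [real_inner_comm (‖z‖⁻¹ • z) x, real_inner_smul_left, real_inner_smul_left, ← hfz, ← hfz]
  gcongr
  exact hle y hy

theorem not_concentratedIn_of_dualCurvatureMeasure {q : ℝ} (hq : q < 0) {μ : Measure (S n)}
    (hK : (0 : E n) ∈ interior (K : Set (E n)))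
    (hμ : ∀ η : Set (S n), MeasurableSet η → μ η = dualCurvatureMeasure q K η) (w : S n) :
    ¬ ConcentratedIn μ (closedHemisphere w) := by
  have hmeas : MeasurableSet (closedHemisphere w) :=
    (isClosed_le continuous_const (by fun_prop)).measurableSet
  have hne : Nonempty (S n) := ⟨w⟩
  obtain ⟨r, hr, hball⟩ := exists_ball_subset hK
  obtain ⟨R, hR⟩ := K.isBounded.subset_closedBall (0 : E n)
  have hR' : ∀ u, radialFn K u ≤ R := fun u => by
    have := hR (radialFn_smul_mem hK u)
    rw [mem_closedBall_zero_iff, norm_smul, norm_eq_of_mem_sphere, mul_one] at this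
    exact (le_abs_self _).trans this
  have hRpos : 0 < R := (radialFn_pos hK w).trans_le (hR' w)
  -- Every normal `v` at the boundary point in direction `u` has `u · v ≥ r / R`, so that
  -- `v · w < 0` once `u` is within `r / R` of `-w`.
  have hsub : Metric.ball (-w) (r / R) ⊆ reverseRadialGaussImage K (closedHemisphere w)ᶜ := by
    intro u hu
    rw [mem_reverseRadialGaussImage_iff]
    obtain ⟨v, hv⟩ := exists_isOuterUnitNormal hK u
    refine ⟨v, ?_, hv⟩
    have h1 : r ≤ supportFn K v := by
      have := inner_le_supportFn K (hball (r • (v : E n)) (by simp [norm_smul, abs_of_pos hr])) v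
      rwa [real_inner_smul_right, inner_self_sphere, mul_one] at this
    rw [IsOuterUnitNormal, real_inner_smul_left] at hv
    have hpos := radialFn_pos hK u
    have h2 : r / R ≤ inner ℝ (u : E n) (v : E n) := by
      rw [div_le_iff₀ hRpos]
      have h3 : 0 ≤ (inner ℝ (u : E n) (v : E n) : ℝ) := by
        by_contra! hneg
        nlinarith
      nlinarith [hR' u]
    have h3 : (inner ℝ ((u : E n) + w) (v : E n) : ℝ) < r / R := by
      have hd : ‖(u : E n) + w‖ < r / R := by
        have := Metric.mem_ball.1 hu
        rw [Subtype.dist_eq, dist_eq_norm] at this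
        simpa using this
      refine lt_of_le_of_lt ?_ hd
      simpa [norm_eq_of_mem_sphere] using real_inner_le_norm ((u : E n) + w) (v : E n)
    rw [inner_add_left, real_inner_comm] at h3
    simp only [closedHemisphere, Set.mem_compl_iff, Set.mem_ofPred_eq, not_le]
    rw [real_inner_comm] at h2
    rw [real_inner_comm]
    linarith
  intro h
  rw [ConcentratedIn, hμ _ hmeas.compl, dualCurvatureMeasure, mul_eq_zero] at h
  rcases h with h | h
  · simp at h
  · have hpos : 0 < ENNReal.ofReal (R ^ q) * sphericalMeasure n (Metric.ball (-w) (r / R)) :=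
      ENNReal.mul_pos (ENNReal.ofReal_pos.2 (rpow_pos_of_pos hRpos q)).ne'
        (sphericalMeasure_pos_of_isOpen Metric.isOpen_ball
          ⟨-w, Metric.mem_ball_self (by positivity)⟩).ne'
    refine hpos.not_ge (le_trans ?_ h.le)
    rw [← setLIntegral_const]
    refine le_trans (lintegral_mono fun u => ENNReal.ofReal_le_ofReal ?_) (lintegral_mono_set hsub)
    exact rpow_le_rpow_of_nonpos (radialFn_pos hK u) (hR' u) hq.le

end Necessity

end DualMinkowski

theorem mainTheorem1 (n : ℕ) (q : ℝ) (hq : q < 0)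
    (μ : Measure (DualMinkowski.S n)) [IsFiniteMeasure μ] (hμ : μ ≠ 0) :
    (∃ K : ConvexBody (DualMinkowski.E n),
        (0 : DualMinkowski.E n) ∈ interior (K : Set (DualMinkowski.E n)) ∧
        ∀ η : Set (DualMinkowski.S n), MeasurableSet η →
          μ η = DualMinkowski.dualCurvatureMeasure q K η) ↔
      ∀ w : DualMinkowski.S n,
        ¬ DualMinkowski.ConcentratedIn μ (DualMinkowski.closedHemisphere w) := by
  constructor
  · rintro ⟨K, hK, hμK⟩ w
    exact DualMinkowski.not_concentratedIn_of_dualCurvatureMeasure hq hK hμK w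
  · intro h
    have hne : Nonempty (DualMinkowski.S n) := by
      by_contra hempty
      rw [not_nonempty_iff] at hempty
      exact hμ (Measure.eq_zero_of_isEmpty μ)
    have hn : n ≠ 0 := by
      rintro rfl
      obtain ⟨v⟩ := hne
      have := norm_eq_of_mem_sphere v
      rw [Subsingleton.elim (v : DualMinkowski.E 0) 0, norm_zero] at this
      exact zero_ne_one this
    exact DualMinkowski.exists_dualCurvatureMeasure_eq hn hq μ h
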